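/- Conventions. A (non-atomic) Lebesgue space is a complete measure space $(X,\mathcal S(X),\mu)$ that is isomorphic mod $0$ to the interval $[0,\mu(X))\subseteq\mathbb R$ with Lebesgue measure. A transformation $T$ of $X$ is nonsingular if it is measurable and $\mu(T^{-1}A)=0\iff\mu(A)=0$ for all measurable $A$. Two systems $(X,\mu,T)$ and $(X_1,\mu_1,T_1)$ are measure-theoretically isomorphic if there are sets $X'\subseteq X$, $X_1'\subseteq X_1$ with null complements, $T(X')\subseteq X'$, $T_1(X_1')\subseteq X_1'$, and a bimeasurable, measure-preserving bijection $\varphi:X'\to X_1'$ with $\varphi\circ T=T_1\circ\varphi$ on $X'$. A metric on a measure space is good if open sets are measurable, all nonempty open sets have positive measure, and the measure is regular. A nonsingular system $(X,\mu,T)$ is measurably sensitive if, whenever a nonsingular system $(X_1,\mu_1,T_1)$ on a Lebesgue space is measure-theoretically isomorphic to $(X,\mu,T)$ and $d$ is a good metric on $X_1$, there exists $\delta>0$ such that for all $x\in X_1$ and all $\varepsilon>0$ there exists $N\in\mathbb N$ such that for all integers $n\ge N$ $$\mu_1\{y\in B_\varepsilon(x): d(T_1^n x,T_1^n y)>\delta\}>0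 .$$ A transformation $S$ of a finite measure space $(Y,\nu)$ is lightly mixing if $\liminf_{k\to\infty}\nu(S^{-k}A\cap B)>0$ for all measurable $A,B\subseteq Y$ of positive measure. Theorem. Let $(X,\mu)$ be a non-atomic Lebesgue space with $0<\mu(X)<\infty$, and let $T:X\to X$ be an ergodic measure-preserving transformation (not necessarily invertible). If $T$ is measurably sensitive, then there are an integer $n\ge 1$ and $n$ pairwise disjoint measurable sets $A_1,\dots,A_n\subseteq X$ of positive measure such that $T^{-n}(A_i)=A_i$ for every $i$, $\mu\bigl(X\setminus\bigcup_{i}A_i\bigr)=0$, and the restriction of $T^n$ to each $A_i$ is lightly mixing with respect to $\mu|_{A_i}$. -/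

import Mathlib

open MeasureTheory Filter Set

universe u v

namespace MeasurableSensitivity

/-- `φ` restricts to an isomorphism of measure spaces between the conull sets `X₀ ⊆ X` and
`Y₀ ⊆ Y`: a bijection that preserves measurability (with respect to the completions) in both
directions and preserves the measure.  When `μ` and `ν` are complete, `NullMeasurableSet` is the
same as `MeasurableSet`. -/
structure IsIsoMod0 {X : Type u} {Y : Type v} [MeasurableSpace X] [MeasurableSpace Y]
    (μ : Measure X) (ν : Measure Y) (X₀ : Set X) (Y₀ : Set Y) (φ : X → Y) : Prop where
  conull_source : μ X₀ᶜ = 0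
  conull_target : ν Y₀ᶜ = 0
  bijOn : BijOn φ X₀ Y₀
  nullMeasurableSet_image_iff :
    ∀ A ⊆ X₀, NullMeasurableSet (φ '' A) ν ↔ NullMeasurableSet A μ
  measure_image : ∀ A ⊆ X₀, NullMeasurableSet A μ → ν (φ '' A) = μ A

/-- A non-atomic Lebesgue space of finite or `σ`-finite measure: a complete measure space that is
isomorphic mod `0` to the interval `[0, μ(X)) ⊆ ℝ` with Lebesgue measure. -/
structure IsLebesgueSpace {X : Type u} [MeasurableSpace X] (μ : Measure X) : Prop where
  complete : μ.IsComplete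
  exists_iso : ∃ (X₀ : Set X) (Y₀ : Set ℝ) (φ : X → ℝ),
    IsIsoMod0 μ (volume.restrict {t : ℝ | 0 ≤ t ∧ ENNReal.ofReal t < μ univ}) X₀ Y₀ φ

/-- `T` is a nonsingular transformation of `(X, μ)`. -/
structure IsNonsingular {X : Type u} [MeasurableSpace X] (μ : Measure X) (T : X → X) :
    Prop where
  measurable : Measurable T
  preimage_null_iff : ∀ A : Set X, MeasurableSet A → (μ (T ⁻¹' A) = 0 ↔ μ A = 0)

/-- The dynamical systems `(X, μ, T)` and `(Y, ν, S)` are measure-theoretically isomorphic: there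
is an isomorphism mod `0` between forward invariant conull sets that intertwines `T` and `S`. -/
def AreIsomorphic {X : Type u} {Y : Type v} [MeasurableSpace X] [MeasurableSpace Y]
    (μ : Measure X) (T : X → X) (ν : Measure Y) (S : Y → Y) : Prop :=
  ∃ (X₀ : Set X) (Y₀ : Set Y) (φ : X → Y), IsIsoMod0 μ ν X₀ Y₀ φ ∧
    MapsTo T X₀ X₀ ∧ MapsTo S Y₀ Y₀ ∧ ∀ x ∈ X₀, φ (T x) = S (φ x)

/-- The metric of `X` is good for the measure `μ`: open sets are measurable, nonempty open sets
have positive measure, and `μ` is regular. -/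
structure IsGoodMetric {X : Type u} [MeasurableSpace X] [MetricSpace X] (μ : Measure X) :
    Prop where
  measurableSet_of_isOpen : ∀ U : Set X, IsOpen U → MeasurableSet U
  measure_pos : ∀ U : Set X, IsOpen U → U.Nonempty → 0 < μ U
  regular : μ.Regular

/-- Measurable sensitivity of a nonsingular dynamical system `(X, μ, T)`. -/
def IsMeasurablySensitive {X : Type u} [MeasurableSpace X] (μ : Measure X) (T : X → X) : Prop :=
  ∀ (X₁ : Type u) [MeasurableSpace X₁] [MetricSpace X₁] (μ₁ : Measure X₁) (T₁ : X₁ → X₁),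
    IsLebesgueSpace μ₁ → IsNonsingular μ₁ T₁ → AreIsomorphic μ T μ₁ T₁ → IsGoodMetric μ₁ →
    ∃ δ : ℝ, 0 < δ ∧ ∀ (x : X₁) (ε : ℝ), 0 < ε → ∃ N : ℕ, ∀ n : ℕ, N ≤ n →
      0 < μ₁ {y | y ∈ Metric.ball x ε ∧ δ < dist (T₁^[n] x) (T₁^[n] y)}

/-- Light mixing of `T` with respect to a finite measure `μ`. -/
def IsLightlyMixing {X : Type u} [MeasurableSpace X] (μ : Measure X) (T : X → X) : Prop :=
  ∀ A B : Set X, MeasurableSet A → MeasurableSet B → 0 < μ A → 0 < μ B →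
    0 < liminf (fun k : ℕ => μ (T^[k] ⁻¹' A ∩ B)) atTop

end MeasurableSensitivity

namespace MeasurableSensitivity

/-! Sensitivity enters only through a uniform bound: some c > 0 bounds from below the measure of
every frequent target (`IsMeasurablySensitive.exists_le_measure`). Otherwise there are frequent
targets C m of summable measure. Coding points by sets F i with F i disjoint from C m for i < m
gives a good metric in which C m has diameter at most 2^(-m). At infinitely many times some ball is
then sent, up to a null set, into C m, against sensitivity.

The bound makes sets invariant under a power of T have measure at least c, so one of nearly minimal
measure is indecomposable. Let D be such a set, strictly invariant under S = T^n. If S^n-images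
failed to mix lightly on D, a set B of positive measure would be sent infinitely often into a proper
part C of D. To x attach the set W(x) of points of D that are in C whenever x is in B. Its measure
is at least c for almost every x in D, and W(x) = S⁻¹ W(S x) a.e., so W is a factor map onto
isometric dynamics in the measure algebra. Recurrence of an isometry turns small balls into frequent
targets. The bound then forces an atom, and indecomposability makes W constant on D. The constant
value is invariant, hence all of D; but W(x) lies in C when x is in B, so C is D up to a null set.
Ergodicity spreads D over the space by preimages. -/

/-- `C` is a frequent target of `T` if, for infinitely many `k`, the map `T^[k]` sends almost all
of some fixed set of positive measure into `C`. -/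
def IsFrequentTarget {X : Type u} [MeasurableSpace X] (μ : Measure X) (T : X → X) (C : Set X) :
    Prop :=
  ∃ B, MeasurableSet B ∧ 0 < μ B ∧ ∃ᶠ k in atTop, B ≤ᵐ[μ] T^[k] ⁻¹' C

/-- Up to null sets, `D` has no nontrivial subset that is invariant under a positive power
of `T`. -/
def IsIndecomposable {X : Type u} [MeasurableSpace X] (μ : Measure X) (T : X → X) (D : Set X) :
    Prop :=
  ∀ m, 1 ≤ m → ∀ E, MeasurableSet E → E ≤ᵐ[μ] D → E =ᵐ[μ] T^[m] ⁻¹' E → μ E = 0 ∨ E =ᵐ[μ] D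

/-! ### Isometric factors and the shadow argument -/

section General

variable {X : Type u} [MeasurableSpace X] {μ : Measure X}

theorem exists_mem_of_ae {D : Set X} (hD : 0 < μ D) {p : X → Prop} (h : ∀ᵐ x ∂μ, p x) :
    ∃ x ∈ D, p x :=
  ((frequently_ae_mem_iff.2 hD.ne').and_eventually h).exists

/-- Applied to countably many sets at once, it supplies a point all of whose neighbourhoods from a
countable family have positive measure. -/
theorem ae_mem_imp_measure_pos (D : Set X) : ∀ᵐ x ∂μ, x ∈ D → 0 < μ D := by
  by_cases h : μ D = 0
  · filter_upwards [measure_eq_zero_iff_ae_notMem.1 h] with x hx hx' using absurd hx' hx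
  · exact .of_forall fun _ _ => pos_iff_ne_zero.2 h

theorem preimage_iterate_eq {X : Type*} {S : X → X} {D : Set X} (h : S ⁻¹' D = D) (n : ℕ) :
    S^[n] ⁻¹' D = D := by
  induction n with
  | zero => rfl
  | succ n ih => rw [Function.iterate_succ, preimage_comp, ih, h]

theorem preimage_iterate_ae_eq {S : X → X} (hS : MeasurePreserving S μ μ) {D : Set X}
    (h : D =ᵐ[μ] S ⁻¹' D) (n : ℕ) : D =ᵐ[μ] S^[n] ⁻¹' D := by
  induction n with
  | zero => rfl
  | succ n ih =>
    rw [Function.iterate_succ, preimage_comp]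
    exact h.trans (hS.quasiMeasurePreserving.preimage_ae_eq ih)

theorem ae_eq_preimage_of_ae_le [IsFiniteMeasure μ] {S : X → X} (hS : MeasurePreserving S μ μ)
    {E : Set X} (hE : MeasurableSet E) (h : E ≤ᵐ[μ] S ⁻¹' E) : E =ᵐ[μ] S ⁻¹' E :=
  ae_eq_of_ae_subset_of_measure_ge h (hS.measure_preimage hE.nullMeasurableSet).le
    hE.nullMeasurableSet (measure_ne_top _ _)

theorem measurable_measure_symmDiff [SFinite μ] {W : X → Set X}
    (hW : MeasurableSet {p : X × X | p.2 ∈ W p.1}) {V : Set X} (hV : MeasurableSet V) :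
    Measurable fun x => μ (symmDiff (W x) V) :=
  measurable_measure_prodMk_left (hW.symmDiff (measurable_snd hV))

theorem measurableSet_section {W : X → Set X} (hW : MeasurableSet {p : X × X | p.2 ∈ W p.1})
    (x : X) : MeasurableSet (W x) :=
  measurable_prodMk_left hW

/-- A measurable family of sets that is equivariant under `S` yields an isometric factor of `S`;
if frequent targets are never small, it is essentially constant on indecomposable sets. -/
theorem exists_ae_eq_of_equivariant [IsFiniteMeasure μ] {S : X → X}
    (hS : MeasurePreserving S μ μ) {c : ENNReal} (hc : 0 < c)
    (h : ∀ C, MeasurableSet C → IsFrequentTarget μ S C → c ≤ μ C) {D : Set X}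
    (hD : MeasurableSet D) (hD0 : 0 < μ D) (hDS : S ⁻¹' D = D) (hind : IsIndecomposable μ S D)
    {W : X → Set X} (hW : MeasurableSet {p : X × X | p.2 ∈ W p.1})
    (hWS : ∀ᵐ x ∂μ, W x =ᵐ[μ] S ⁻¹' W (S x)) {ι : Type*} [Countable ι] {V : ι → Set X}
    (hV : ∀ x, ∀ ε, 0 < ε → ∃ i, μ (symmDiff (W x) (V i)) < ε) :
    ∃ x₀, ∀ᵐ z ∂μ, z ∈ D → W z =ᵐ[μ] W x₀ := by
  have hWm := measurableSet_section hW
  have hiter : ∀ᵐ x ∂μ, ∀ n, W x =ᵐ[μ] S^[n] ⁻¹' W (S^[n] x) := by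
    refine ae_all_iff.2 fun n => ?_
    induction n with
    | zero => exact .of_forall fun x => ae_eq_rfl
    | succ n ih =>
      filter_upwards [ih, (hS.iterate n).quasiMeasurePreserving.ae hWS] with x hx hx'
      rw [Function.iterate_succ', Function.comp_apply, preimage_comp]
      exact hx.trans ((hS.iterate n).quasiMeasurePreserving.preimage_ae_eq hx')
  have hisom : ∀ x z, (∀ n, W x =ᵐ[μ] S^[n] ⁻¹' W (S^[n] x)) →
      (∀ n, W z =ᵐ[μ] S^[n] ⁻¹' W (S^[n] z)) → ∀ n,
      μ (symmDiff (W (S^[n] x)) (W (S^[n] z))) = μ (symmDiff (W x) (W z)) := by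
    intro x z hx hz n
    rw [← (hS.iterate n).measure_preimage ((hWm _).symmDiff (hWm _)).nullMeasurableSet]
    exact measure_congr ((hx n).symm.symmDiff (hz n).symm)
  -- `W x₀` is chosen in the support of the law of `W` on `D`: every ball of radius 1/m about some
  -- `V i` that contains it has positive measure.
  obtain ⟨x₀, hx₀D, hx₀⟩ := exists_mem_of_ae hD0 (ae_all_iff.2 fun m : ℕ => ae_all_iff.2 fun i =>
    ae_mem_imp_measure_pos (μ := μ) {z | z ∈ D ∧ μ (symmDiff (W z) (V i)) < (m : ENNReal)⁻¹})
  set Q : ENNReal → Set X := fun e => {z | z ∈ D ∧ μ (symmDiff (W z) (W x₀)) < e} with hQ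
  have hQm : ∀ e, MeasurableSet (Q e) := fun e =>
    hD.inter (measurable_measure_symmDiff hW (hWm x₀) measurableSet_Iio)
  have hQpos : ∀ e, 0 < e → 0 < μ (Q e) := by
    intro e he
    obtain ⟨m, hm⟩ := ENNReal.exists_inv_nat_lt (ENNReal.half_pos he.ne').ne'
    obtain ⟨i, hi⟩ := hV x₀ (m : ENNReal)⁻¹ (by simp)
    refine (hx₀ m i ⟨hx₀D, hi⟩).trans_le (measure_mono fun z hz => ⟨hz.1, ?_⟩)
    calc μ (symmDiff (W z) (W x₀)) ≤ μ (symmDiff (W z) (V i)) + μ (symmDiff (V i) (W x₀)) :=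
          measure_symmDiff_le _ _ _
      _ < e / 2 + e / 2 := by
          refine ENNReal.add_lt_add (hz.2.trans hm) ?_
          rw [symmDiff_comm]; exact hi.trans hm
      _ = e := ENNReal.add_halves e
  have hstep : ∀ n x z, (∀ n, W x =ᵐ[μ] S^[n] ⁻¹' W (S^[n] x)) →
      (∀ n, W z =ᵐ[μ] S^[n] ⁻¹' W (S^[n] z)) →
      μ (symmDiff (W (S^[n] z)) (W x₀)) ≤
        μ (symmDiff (W z) (W x₀)) + μ (symmDiff (W x) (W x₀)) +
          μ (symmDiff (W (S^[n] x)) (W x₀)) := by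
    intro n x z hx hz
    refine (measure_symmDiff_le _ (W (S^[n] x)) _).trans ?_
    gcongr
    rw [hisom z x hz hx, symmDiff_comm (W x)]
    exact measure_symmDiff_le _ _ _
  have hmapD : ∀ n, ∀ z ∈ D, S^[n] z ∈ D := fun n z hz => by
    rw [← preimage_iterate_eq hDS n] at hz; exact hz
  have hQc : ∀ e, 0 < e → c ≤ μ (Q e) := by
    intro e he
    have he3 : 0 < e / 3 := ENNReal.div_pos he.ne' (by simp)
    -- When one point of `Q (e / 3)` returns to it, the isometry carries almost all of `Q (e / 3)`
    -- into `Q e`: three errors of e/3.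
    refine h _ (hQm e) ⟨Q (e / 3), hQm _, hQpos _ he3, ?_⟩
    obtain ⟨x, hxQ, hx, hxr⟩ := exists_mem_of_ae (hQpos _ he3)
      (hiter.and (hS.conservative.ae_mem_imp_frequently_image_mem (hQm (e / 3)).nullMeasurableSet))
    refine (hxr hxQ).mono fun n hn => ?_
    filter_upwards [hiter] with z hz hzQ
    refine ⟨hmapD n z hzQ.1, (hstep n x z hx hz).trans_lt ?_⟩
    calc _ < e / 3 + e / 3 + e / 3 :=
          ENNReal.add_lt_add (ENNReal.add_lt_add hzQ.2 hxQ.2) hn.2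
      _ = e := ENNReal.add_thirds e
  set E : Set X := {z | z ∈ D ∧ μ (symmDiff (W z) (W x₀)) = 0} with hE
  have hEm : MeasurableSet E :=
    hD.inter (measurable_measure_symmDiff hW (hWm x₀) (measurableSet_singleton 0))
  have hEQ : E = ⋂ m : ℕ, Q (m : ENNReal)⁻¹ := by
    ext z
    simp only [hE, hQ, mem_ofPred_eq, mem_iInter]
    refine ⟨fun hz m => ⟨hz.1, by simp [hz.2]⟩, fun hz => ⟨(hz 0).1, ?_⟩⟩
    by_contra hne
    obtain ⟨m, hm⟩ := ENNReal.exists_inv_nat_lt hne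
    exact (hz m).2.not_gt hm
  have hEc : c ≤ μ E := by
    rw [hEQ]
    refine ge_of_tendsto' (tendsto_measure_iInter_atTop (fun m => (hQm _).nullMeasurableSet)
      (fun m n hmn z hz => ⟨hz.1, hz.2.trans_le ?_⟩) ⟨0, measure_ne_top _ _⟩)
      fun m => hQc _ (by simp)
    exact ENNReal.inv_le_inv.2 (by exact_mod_cast hmn)
  -- A return of a single point of `E` at a time n ≥ 1 forces `E` into its preimage under `S^[n]`,
  -- since all distances involved are zero.
  obtain ⟨x, hxE, hx, hxr⟩ := exists_mem_of_ae (hc.trans_le hEc)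
    (hiter.and (hS.conservative.ae_mem_imp_frequently_image_mem hEm.nullMeasurableSet))
  obtain ⟨n, hn, hnE⟩ := (frequently_atTop.1 (hxr hxE)) 1
  have hEle : E ≤ᵐ[μ] S^[n] ⁻¹' E := by
    filter_upwards [hiter] with z hz hzE
    refine ⟨hmapD n z hzE.1, le_antisymm ((hstep n x z hx hz).trans ?_) bot_le⟩
    rw [hzE.2, hxE.2, hnE.2]; simp
  have hED := (hind n hn E hEm (.of_forall fun z hz => hz.1)
    (ae_eq_preimage_of_ae_le (hS.iterate n) hEm hEle)).resolve_left (hc.trans_le hEc).ne'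
  refine ⟨x₀, ?_⟩
  filter_upwards [hED.mem_iff] with z hz hzD
  exact measure_symmDiff_eq_zero_iff.1 (hz.2 hzD).2

/-- The points `y ∈ D` that visit `C` whenever `x` visits `B`. -/
def shadow {X : Type*} (S : X → X) (B C D : Set X) (x : X) : Set X :=
  {y | y ∈ D ∧ ∀ j, S^[j] x ∈ B → S^[j] y ∈ C}

/-- The points of `D` that visit `C` at all the times in `F`. -/
def visiting {X : Type*} (S : X → X) (C D : Set X) (F : Finset ℕ) : Set X :=
  {y | y ∈ D ∧ ∀ j ∈ F, S^[j] y ∈ C}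

theorem measurableSet_visiting {S : X → X} (hS : Measurable S) {C D : Set X}
    (hC : MeasurableSet C) (hD : MeasurableSet D) (F : Finset ℕ) :
    MeasurableSet (visiting S C D F) := by
  have : visiting S C D F = D ∩ ⋂ j ∈ F, S^[j] ⁻¹' C := by
    ext; simp [visiting]
  rw [this]
  exact hD.inter (Finset.measurableSet_biInter _ fun j _ => hS.iterate j hC)

theorem measurableSet_shadow {S : X → X} (hS : Measurable S) {B C D : Set X}
    (hB : MeasurableSet B) (hC : MeasurableSet C) (hD : MeasurableSet D) :
    MeasurableSet {p : X × X | p.2 ∈ shadow S B C D p.1} := by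
  have : {p : X × X | p.2 ∈ shadow S B C D p.1} = Prod.snd ⁻¹' D ∩
      ⋂ j : ℕ, ((Prod.fst ⁻¹' (S^[j] ⁻¹' B))ᶜ ∪ Prod.snd ⁻¹' (S^[j] ⁻¹' C)) := by
    ext p; simp [shadow, imp_iff_not_or]
  rw [this]
  exact (measurable_snd hD).inter (.iInter fun j =>
    (measurable_fst (hS.iterate j hB)).compl.union (measurable_snd (hS.iterate j hC)))

open Classical in
theorem shadow_eq_iInter {X : Type*} (S : X → X) (B C D : Set X) (x : X) :
    shadow S B C D x =
      ⋂ N : ℕ, visiting S C D ((Finset.range N).filter fun j => S^[j] x ∈ B) := by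
  ext y
  simp only [shadow, visiting, mem_ofPred_eq, mem_iInter, Finset.mem_filter, Finset.mem_range]
  exact ⟨fun h N => ⟨h.1, fun j hj => h.2 j hj.2⟩,
    fun h => ⟨(h 0).1, fun j hj => (h (j + 1)).2 j ⟨j.lt_succ_self, hj⟩⟩⟩

open Classical in
theorem tendsto_measure_visiting [IsFiniteMeasure μ] {S : X → X} (hS : Measurable S)
    {B C D : Set X} (hC : MeasurableSet C) (hD : MeasurableSet D) (x : X) :
    Tendsto (fun N => μ (visiting S C D ((Finset.range N).filter fun j => S^[j] x ∈ B))) atTop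
      (nhds (μ (shadow S B C D x))) := by
  rw [shadow_eq_iInter]
  refine tendsto_measure_iInter_atTop
    (fun N => (measurableSet_visiting hS hC hD _).nullMeasurableSet)
    (fun M N hMN y hy => ⟨hy.1, fun j hj => hy.2 j ?_⟩) ⟨0, measure_ne_top _ _⟩
  simp only [Finset.mem_filter, Finset.mem_range] at hj ⊢
  exact ⟨hj.1.trans_le hMN, hj.2⟩

theorem exists_visiting_approx [IsFiniteMeasure μ] {S : X → X} (hS : Measurable S)
    {B C D : Set X} (hB : MeasurableSet B) (hC : MeasurableSet C) (hD : MeasurableSet D) (x : X)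
    {ε : ENNReal} (hε : 0 < ε) :
    ∃ F, μ (symmDiff (shadow S B C D x) (visiting S C D F)) < ε := by
  classical
  have hlt : μ (shadow S B C D x) < μ (shadow S B C D x) + ε :=
    ENNReal.lt_add_right (measure_ne_top _ _) hε.ne'
  obtain ⟨N, hN⟩ := ((tendsto_measure_visiting hS hC hD x).eventually_lt_const hlt).exists
  refine ⟨(Finset.range N).filter fun j => S^[j] x ∈ B, ?_⟩
  have hsub : shadow S B C D x ⊆
      visiting S C D ((Finset.range N).filter fun j => S^[j] x ∈ B) := by
    rw [shadow_eq_iInter]; exact iInter_subset _ N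
  rw [Set.symmDiff_def, sdiff_eq_empty.2 hsub, empty_union,
    measure_sdiff hsub (measurableSet_section (measurableSet_shadow hS hB hC hD) x).nullMeasurableSet
      (measure_ne_top _ _)]
  exact ENNReal.sub_lt_of_lt_add (measure_mono hsub) (by rwa [add_comm])

/-- A time k that sends `B` into `C` works simultaneously at all visits in `F`, because S^k commutes
with S^j. -/
theorem isFrequentTarget_visiting {S : X → X} (hS : Measurable S) {B C D : Set X}
    (hB : MeasurableSet B) (hD : MeasurableSet D) (hDS : S ⁻¹' D = D)
    (hBC : ∃ᶠ k in atTop, B ⊆ S^[k] ⁻¹' C) {F : Finset ℕ} (hF : 0 < μ (visiting S B D F)) :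
    IsFrequentTarget μ S (visiting S C D F) := by
  refine ⟨_, measurableSet_visiting hS hB hD F, hF, hBC.mono fun k hk => .of_forall fun y hy => ?_⟩
  refine ⟨?_, fun j hj => ?_⟩
  · have := hy.1; rw [← preimage_iterate_eq hDS k] at this; exact this
  · rw [← Function.iterate_add_apply, add_comm, Function.iterate_add_apply]
    exact hk (hy.2 j hj)

/-- If frequent targets are never small, then no proper part of an indecomposable set is hit
infinitely often by the images of a fixed set of positive measure. -/
theorem measure_sdiff_eq_zero_of_isIndecomposable [IsFiniteMeasure μ] {S : X → X}
    (hS : MeasurePreserving S μ μ) {c : ENNReal} (hc : 0 < c)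
    (h : ∀ C, MeasurableSet C → IsFrequentTarget μ S C → c ≤ μ C) {D : Set X}
    (hD : MeasurableSet D) (hDS : S ⁻¹' D = D) (hind : IsIndecomposable μ S D) {B C : Set X}
    (hB : MeasurableSet B) (hB0 : 0 < μ B) (hBD : B ⊆ D) (hC : MeasurableSet C)
    (hBC : ∃ᶠ k in atTop, B ⊆ S^[k] ⁻¹' C) : μ (D \ C) = 0 := by
  classical
  have hD0 : 0 < μ D := hB0.trans_le (measure_mono hBD)
  have hWm := measurableSet_shadow hS.measurable hB hC hD
  have hWle : ∀ᵐ x ∂μ, x ∈ D → c ≤ μ (shadow S B C D x) := by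
    filter_upwards [ae_all_iff.2 fun F => ae_mem_imp_measure_pos (μ := μ) (visiting S B D F)]
      with x hx hxD
    -- The finite set of visits of x to `B` before time N is realised by x itself, so for generic x
    -- it is realised by a set of positive measure.
    refine ge_of_tendsto' (tendsto_measure_visiting hS.measurable hC hD x) fun N => h _
      (measurableSet_visiting hS.measurable hC hD _) (isFrequentTarget_visiting hS.measurable hB
        hD hDS hBC (hx _ ⟨hxD, fun j hj => (Finset.mem_filter.1 hj).2⟩))
  have hsub : ∀ x, shadow S B C D x ⊆ S ⁻¹' shadow S B C D (S x) := by
    intro x y hy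
    refine ⟨?_, fun j hj => ?_⟩
    · have := hy.1; rw [← hDS] at this; exact this
    · exact hy.2 (j + 1) hj
  have hmeas : Measurable fun x => μ (shadow S B C D x) := measurable_measure_prodMk_left hWm
  have hWS : ∀ᵐ x ∂μ, shadow S B C D x =ᵐ[μ] S ⁻¹' shadow S B C D (S x) := by
    have heq : ∀ x, μ (S ⁻¹' shadow S B C D (S x)) = μ (shadow S B C D (S x)) := fun x =>
      hS.measure_preimage (measurableSet_section hWm _).nullMeasurableSet
    -- The measure of the shadow can only grow along the orbit, while its integral is preserved;
    -- hence it is a.e. constant along orbits and the inclusion is an equality.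
    have := ae_eq_of_ae_le_of_lintegral_le (μ := μ) (f := fun x => μ (shadow S B C D x))
      (g := fun x => μ (shadow S B C D (S x)))
      (.of_forall fun x => (measure_mono (hsub x)).trans (heq x).le)
      ((lintegral_mono fun x => measure_mono (subset_univ _)).trans_lt (by
        rw [lintegral_const]
        exact ENNReal.mul_lt_top (measure_lt_top _ _) (measure_lt_top _ _))).ne
      (hmeas.comp hS.measurable).aemeasurable (hS.lintegral_comp hmeas).le
    filter_upwards [this] with x hx
    exact ae_eq_of_ae_subset_of_measure_ge (.of_forall (hsub x)) ((heq x).trans hx.symm).le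
      (measurableSet_section hWm x).nullMeasurableSet (measure_ne_top _ _)
  obtain ⟨x₀, hx₀⟩ := exists_ae_eq_of_equivariant hS hc h hD hD0 hDS hind hWm hWS
    fun x ε hε => exists_visiting_approx hS.measurable hB hC hD x hε
  obtain ⟨z, hzB, hzle, hzS, hz, hSz⟩ := exists_mem_of_ae hB0 (hWle.and (hWS.and (hx₀.and
    (hS.quasiMeasurePreserving.ae hx₀))))
  have hzD := hBD hzB
  have hSzD : S z ∈ D := by rw [← hDS] at hzD; exact hzD
  have hinv : shadow S B C D z =ᵐ[μ] S ⁻¹' shadow S B C D z :=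
    hzS.trans (hS.quasiMeasurePreserving.preimage_ae_eq ((hSz hSzD).trans (hz hzD).symm))
  have hfull := (hind 1 le_rfl _ (measurableSet_section hWm z) (.of_forall fun y hy => hy.1)
    hinv).resolve_left (hc.trans_le (hzle hzD)).ne'
  refine measure_mono_null (fun y hy => ?_) (ae_eq_set.1 hfull).2
  -- Since z is in `B`, time 0 already puts its shadow inside `C`.
  exact ⟨hy.1, fun hy' => hy.2 (hy'.2 0 hzB)⟩

end General

/-! ### Indecomposable sets, light mixing and the cyclic decomposition -/

section Decomposition

variable {X : Type u} [MeasurableSpace X] {μ : Measure X}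

/-- Along a sequence of times the sets S⁻ᵏA ∩ B have total measure less than that of `B`; removing
them all leaves the required set. -/
theorem exists_subset_frequently_subset_preimage [IsFiniteMeasure μ] {S : X → X}
    (hS : Measurable S) {A B : Set X} (hA : MeasurableSet A) (hB : MeasurableSet B)
    (hB0 : 0 < μ B) (h : liminf (fun k : ℕ => μ (S^[k] ⁻¹' A ∩ B)) atTop = 0) :
    ∃ B' ⊆ B, MeasurableSet B' ∧ 0 < μ B' ∧ ∃ᶠ k in atTop, B' ⊆ S^[k] ⁻¹' Aᶜ := by
  obtain ⟨ε, hε, hsum⟩ := ENNReal.exists_pos_sum_of_countable hB0.ne' ℕ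
  have hk : ∀ i : ℕ, ∃ k, i ≤ k ∧ μ (S^[k] ⁻¹' A ∩ B) < ε i := fun i =>
    frequently_atTop.1 (frequently_lt_of_liminf_lt (by isBoundedDefault)
      (h.trans_lt (ENNReal.coe_pos.2 (hε i)))) i
  choose k hik hk using hk
  have hm : MeasurableSet (⋃ i, S^[k i] ⁻¹' A ∩ B) := .iUnion fun i => (hS.iterate _ hA).inter hB
  refine ⟨B \ ⋃ i, S^[k i] ⁻¹' A ∩ B, sdiff_subset, hB.diff hm, ?_, frequently_atTop.2 fun i =>
    ⟨k i, hik i, fun x hx hxA => hx.2 (mem_iUnion.2 ⟨i, hxA, hx.1⟩)⟩⟩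
  refine lt_of_lt_of_le (tsub_pos_of_lt ?_) le_measure_sdiff
  exact ((measure_iUnion_le _).trans (ENNReal.tsum_le_tsum fun i => (hk i).le)).trans_lt hsum

theorem isFrequentTarget_of_ae_eq_preimage {T : X → X} (hT : MeasurePreserving T μ μ) {n : ℕ}
    (hn : 1 ≤ n) {E : Set X} (hE : MeasurableSet E) (hE0 : 0 < μ E) (h : E =ᵐ[μ] T^[n] ⁻¹' E) :
    IsFrequentTarget μ T E := by
  refine ⟨E, hE, hE0, frequently_atTop.2 fun N => ⟨n * N, Nat.le_mul_of_pos_left N hn, ?_⟩⟩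
  rw [Function.iterate_mul]
  exact (preimage_iterate_ae_eq (hT.iterate n) h N).le

theorem IsFrequentTarget.of_iterate {T : X → X} {n : ℕ} (hn : 1 ≤ n) {C : Set X}
    (h : IsFrequentTarget μ T^[n] C) : IsFrequentTarget μ T C := by
  obtain ⟨B, hB, hB0, hk⟩ := h
  refine ⟨B, hB, hB0, frequently_atTop.2 fun N => ?_⟩
  obtain ⟨k, hkN, hk⟩ := frequently_atTop.1 hk N
  exact ⟨n * k, hkN.trans (Nat.le_mul_of_pos_left k hn), by rwa [Function.iterate_mul]⟩

theorem IsIndecomposable.iterate {T : X → X} {D : Set X} (h : IsIndecomposable μ T D) {n : ℕ}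
    (hn : 1 ≤ n) : IsIndecomposable μ T^[n] D := by
  intro m hm E hE hED hEm
  rw [← Function.iterate_mul] at hEm
  exact h (n * m) (Nat.mul_pos hn hm) E hE hED hEm

theorem IsIndecomposable.congr {T : X → X} {D D' : Set X} (h : IsIndecomposable μ T D)
    (hD : D =ᵐ[μ] D') : IsIndecomposable μ T D' := fun m hm E hE hED hEm =>
  (h m hm E hE (hED.trans hD.symm.le) hEm).imp_right fun hE => hE.trans hD

/-- The infimum of the measures of sets invariant under a power is at least c > 0. A set of measure
below twice the infimum cannot split into two such sets. -/
theorem exists_isIndecomposable [IsFiniteMeasure μ] (hμ : μ ≠ 0) {T : X → X}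
    (hT : MeasurePreserving T μ μ) {c : ENNReal} (hc : 0 < c)
    (h : ∀ C, MeasurableSet C → IsFrequentTarget μ T C → c ≤ μ C) :
    ∃ D, MeasurableSet D ∧ 0 < μ D ∧ (∃ n, 1 ≤ n ∧ D =ᵐ[μ] T^[n] ⁻¹' D) ∧
      IsIndecomposable μ T D := by
  set I : Set ENNReal := {r | ∃ E, MeasurableSet E ∧ 0 < μ E ∧
    (∃ n, 1 ≤ n ∧ E =ᵐ[μ] T^[n] ⁻¹' E) ∧ μ E = r}
  have hI : c ≤ sInf I := le_sInf fun r ⟨E, hE, hE0, ⟨n, hn, hEn⟩, hr⟩ => hr ▸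
    h E hE (isFrequentTarget_of_ae_eq_preimage hT hn hE hE0 hEn)
  have huniv : μ univ ∈ I :=
    ⟨univ, .univ, by simpa [pos_iff_ne_zero] using hμ, ⟨1, le_rfl, by simp⟩, rfl⟩
  have hfin : sInf I ≠ ⊤ := ((sInf_le huniv).trans_lt (measure_lt_top _ _)).ne
  have hlt : sInf I < sInf I + sInf I := ENNReal.lt_add_right hfin (hc.trans_le hI).ne'
  obtain ⟨_, ⟨D, hD, hD0, ⟨n, hn, hDn⟩, rfl⟩, hDlt⟩ := sInf_lt_iff.1 hlt
  refine ⟨D, hD, hD0, ⟨n, hn, hDn⟩, fun m hm E hE hED hEm => ?_⟩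
  by_contra! hne
  have hE' : (E ∩ D : Set X) =ᵐ[μ] E := 
    ae_eq_set.2 ⟨by rw [sdiff_eq_empty.2 inter_subset_left, measure_empty],
      by rw [sdiff_self_inter]; exact ae_le_set.1 hED⟩
  have hDnm : D =ᵐ[μ] T^[n * m] ⁻¹' D := by
    rw [Function.iterate_mul]; exact preimage_iterate_ae_eq (hT.iterate n) hDn m
  have hEnm : E =ᵐ[μ] T^[n * m] ⁻¹' E := by
    rw [mul_comm, Function.iterate_mul]; exact preimage_iterate_ae_eq (hT.iterate m) hEm n
  have hdiff : 0 < μ (D \ E) := by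
    refine pos_iff_ne_zero.2 fun h0 => hne.2 (hED.antisymm ?_)
    exact ae_le_set.2 h0
  have h1 : sInf I ≤ μ (D ∩ E) := by
    rw [inter_comm, measure_congr hE']
    exact sInf_le ⟨E, hE, pos_iff_ne_zero.2 hne.1, ⟨m, hm, hEm⟩, rfl⟩
  have h2 : sInf I ≤ μ (D \ E) :=
    sInf_le ⟨D \ E, hD.diff hE, hdiff, ⟨n * m, Nat.mul_pos hn hm, hDnm.diff hEnm⟩, rfl⟩
  rw [← measure_inter_add_sdiff D hE] at hDlt
  exact hDlt.not_ge (add_le_add h1 h2)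

/-- A further pullback by T^(n-i) carries subsets of T⁻ⁱD back to subsets of `D`. -/
theorem IsIndecomposable.preimage [IsFiniteMeasure μ] {T : X → X} (hT : MeasurePreserving T μ μ)
    {D : Set X} (hD : MeasurableSet D) (h : IsIndecomposable μ T D) {n i : ℕ} (hi : i ≤ n)
    (hDn : T^[n] ⁻¹' D = D) : IsIndecomposable μ T (T^[i] ⁻¹' D) := by
  intro m hm E hE hED hEm
  have hi' := hT.iterate (n - i)
  have hmeas : μ (T^[n - i] ⁻¹' E) = μ E := hi'.measure_preimage hE.nullMeasurableSet
  have hsub : T^[n - i] ⁻¹' E ≤ᵐ[μ] D := by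
    have := hi'.quasiMeasurePreserving.preimage_mono_ae hED
    rwa [← preimage_comp, ← Function.iterate_add, Nat.add_sub_cancel' hi, hDn] at this
  have hinv : T^[n - i] ⁻¹' E =ᵐ[μ] T^[m] ⁻¹' (T^[n - i] ⁻¹' E) := by
    have := hi'.quasiMeasurePreserving.preimage_ae_eq hEm
    rwa [← preimage_comp, ← Function.iterate_add, add_comm, Function.iterate_add,
      preimage_comp] at this
  refine (h m hm _ (hi'.measurable hE) hsub hinv).imp (fun h0 => hmeas.symm.trans h0) fun heq => ?_
  refine ae_eq_of_ae_subset_of_measure_ge hED ?_ hE.nullMeasurableSet (measure_ne_top _ _)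
  rw [(hT.iterate i).measure_preimage hD.nullMeasurableSet, ← hmeas, measure_congr heq]

theorem isLightlyMixing_restrict_of_isIndecomposable [IsFiniteMeasure μ] {T : X → X}
    (hT : MeasurePreserving T μ μ) {c : ENNReal} (hc : 0 < c)
    (h : ∀ C, MeasurableSet C → IsFrequentTarget μ T C → c ≤ μ C) {D : Set X}
    (hD : MeasurableSet D) {n : ℕ} (hn : 1 ≤ n) (hDn : T^[n] ⁻¹' D = D)
    (hind : IsIndecomposable μ T D) : IsLightlyMixing (μ.restrict D) T^[n] := by
  intro A B hA hB hA0 hB0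
  rw [Measure.restrict_apply hA] at hA0
  rw [Measure.restrict_apply hB] at hB0
  rw [pos_iff_ne_zero]
  intro h0
  have hTn := hT.iterate n
  simp_rw [Measure.restrict_apply' hD, inter_assoc] at h0
  obtain ⟨B', hB'B, hB', hB'0, hfreq⟩ := exists_subset_frequently_subset_preimage hTn.measurable
    hA (hB.inter hD) hB0 h0
  have := measure_sdiff_eq_zero_of_isIndecomposable hTn hc
    (fun C hC hCt => h C hC (hCt.of_iterate hn)) hD hDn (hind.iterate hn) (C := D \ A) hB' hB'0
    (hB'B.trans inter_subset_right) (hD.diff hA) (hfreq.mono fun k hk x hx => ⟨?_, hk hx⟩)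
  · rw [sdiff_sdiff_right_self, inter_comm] at this
    exact hA0.ne' this
  · have := (hB'B hx).2
    rw [← preimage_iterate_eq hDn k] at this
    exact this

/-- If frequent targets are never small, an ergodic transformation has a cyclic decomposition
into finitely many sets on which a power of it is lightly mixing. -/
theorem exists_cyclic_decomposition [IsFiniteMeasure μ] (hμ : μ ≠ 0) {T : X → X}
    (hT : Ergodic T μ) {c : ENNReal} (hc : 0 < c)
    (h : ∀ C, MeasurableSet C → IsFrequentTarget μ T C → c ≤ μ C) :
    ∃ n : ℕ, 1 ≤ n ∧ ∃ A : Fin n → Set X,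
      (∀ i, MeasurableSet (A i)) ∧
      (∀ i, 0 < μ (A i)) ∧
      (∀ i j, i ≠ j → Disjoint (A i) (A j)) ∧
      (∀ i, T^[n] ⁻¹' (A i) = A i) ∧
      μ (⋃ i, A i)ᶜ = 0 ∧
      (∀ i, IsLightlyMixing (μ.restrict (A i)) (T^[n])) := by
  classical
  have hTm := hT.toMeasurePreserving
  obtain ⟨D₀, hD₀, hD₀0, hex, hind₀⟩ := exists_isIndecomposable hμ hTm hc h
  obtain ⟨hn, hD₀n⟩ := Nat.find_spec hex
  have hmin := fun m => Nat.find_min (H := hex) (m := m)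
  set n := Nat.find hex
  obtain ⟨D, hD, hDD₀, hDn⟩ := (hTm.iterate n).quasiMeasurePreserving.exists_preimage_eq_of_preimage_ae
    hD₀.nullMeasurableSet hD₀n.symm
  have hind := hind₀.congr hDD₀.symm
  have hcomm : ∀ (E : Set X) (j : ℕ), T^[n] ⁻¹' E = E → T^[n] ⁻¹' (T^[j] ⁻¹' E) = T^[j] ⁻¹' E := by
    intro E j hE
    rw [← preimage_comp, ← Function.iterate_add, add_comm, Function.iterate_add, preimage_comp, hE]
  -- The overlap is invariant under T^n, so it is null or all of `D`; the latter would make j < n a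
  -- period of `D`, against the minimality of n.
  have hnull : ∀ j ∈ Finset.Ioo 0 n, μ (D ∩ T^[j] ⁻¹' D) = 0 := by
    intro j hj
    rw [Finset.mem_Ioo] at hj
    have hjm := (hTm.iterate j).measurable hD
    refine (hind n hn _ (hD.inter hjm) (.of_forall fun x hx => hx.1) ?_).resolve_right fun heq => ?_
    · rw [preimage_inter, hDn, hcomm D j hDn]; rfl
    · have hle : D ≤ᵐ[μ] T^[j] ⁻¹' D := heq.symm.le.trans (.of_forall fun x hx => hx.2)
      have := ae_eq_preimage_of_ae_le (hTm.iterate j) hD hle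
      exact hmin j hj.2 ⟨hj.1, hDD₀.symm.trans (this.trans
        ((hTm.iterate j).quasiMeasurePreserving.preimage_ae_eq hDD₀))⟩
  -- Removing the null overlaps makes the preimages disjoint on the nose and keeps strict invariance
  -- under T^n.
  set E : Set X := D \ ⋃ j ∈ Finset.Ioo 0 n, T^[j] ⁻¹' D with hE
  have hEm : MeasurableSet E :=
    hD.diff (Finset.measurableSet_biUnion _ fun j _ => (hTm.iterate j).measurable hD)
  have hED : E =ᵐ[μ] D := by
    refine ae_eq_set.2 ⟨by simp [hE], ?_⟩
    rw [hE, Set.sdiff_sdiff_right_self, inter_iUnion₂]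
    exact (measure_biUnion_null_iff (Finset.Ioo 0 n).countable_toSet).2 hnull
  have hEn : T^[n] ⁻¹' E = E := by
    simp only [hE, preimage_sdiff, preimage_iUnion, hDn, hcomm D _ hDn]
  have hE0 : 0 < μ E := by rwa [measure_congr (hED.trans hDD₀)]
  have hindE := hind.congr hED.symm
  have hAm : ∀ i : ℕ, MeasurableSet (T^[i] ⁻¹' E) := fun i => (hTm.iterate i).measurable hEm
  have hdisj : ∀ i j : ℕ, i < j → j < n → Disjoint (T^[i] ⁻¹' E) (T^[j] ⁻¹' E) := by
    intro i j hij hj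
    refine disjoint_left.2 fun x hxi hxj => hxi.2 ?_
    refine mem_iUnion₂.2 ⟨j - i, Finset.mem_Ioo.2 ⟨by omega, by omega⟩, ?_⟩
    change T^[j - i] (T^[i] x) ∈ D
    rw [← Function.iterate_add_apply, Nat.sub_add_cancel hij.le]
    exact hxj.1
  refine ⟨n, hn, fun i => T^[i] ⁻¹' E, fun i => hAm i, fun i => ?_, fun i j hij => ?_,
    fun i => hcomm E i hEn, ?_, fun i => ?_⟩
  · rwa [(hTm.iterate i).measure_preimage hEm.nullMeasurableSet]
  · rcases lt_or_gt_of_ne (Fin.val_ne_of_ne hij) with hlt | hlt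
    · exact hdisj i j hlt j.2
    · exact (hdisj j i hlt i.2).symm
  · have hsub : T ⁻¹' (⋃ i : Fin n, T^[i] ⁻¹' E) ⊆ ⋃ i : Fin n, T^[i] ⁻¹' E := by
      intro x hx
      obtain ⟨i, hi⟩ := mem_iUnion.1 hx
      change T^[i] (T x) ∈ E at hi
      rw [← Function.iterate_succ_apply] at hi
      -- The index n wraps around to 0.
      rcases (Nat.succ_le_of_lt i.2).lt_or_eq with hlt | heq
      · exact mem_iUnion.2 ⟨⟨_, hlt⟩, hi⟩
      · have hx' : x ∈ T^[n] ⁻¹' E := by rw [← heq]; exact hi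
        rw [hEn] at hx'
        exact mem_iUnion.2 ⟨⟨0, hn⟩, hx'⟩
    rcases hT.ae_empty_or_univ_of_preimage_ae_le
      (MeasurableSet.iUnion fun i : Fin n => hAm i).nullMeasurableSet (.of_forall hsub) with h0 | h1
    · have h0' := ae_eq_empty.1 h0
      refine absurd (measure_mono_null (fun x hx => ?_) h0') hE0.ne'
      exact mem_iUnion.2 ⟨⟨0, hn⟩, hx⟩
    · exact ae_eq_univ.1 h1
  · exact isLightlyMixing_restrict_of_isIndecomposable hTm hc h (hAm i) hn (hcomm E i hEn)
      (hindE.preimage hTm hEm i.2.le hEn)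

end Decomposition

/-! ### Regularity of the measure for a topology induced from a Polish space -/

section Regular

/-- An injective measurable map from a space that is isomorphic to a set of reals into a Polish
space pulls back the tightness of finite measures. -/
theorem exists_isCompact_measure_sdiff_preimage_lt {Y : Type*} [MeasurableSpace Y] {κ : Measure Y}
    [IsFiniteMeasure κ] {ν : Measure ℝ} {Y₀ : Set ℝ} {ψ : Y → ℝ} (hψ : IsIsoMod0 κ ν univ Y₀ ψ)
    {Z : Type*} [TopologicalSpace Z] [PolishSpace Z] [MeasurableSpace Z] [BorelSpace Z]
    {Φ : Y → Z} (hΦ : Measurable Φ) (hinj : Function.Injective Φ) {A : Set Y}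
    (hA : MeasurableSet A) {ε : ENNReal} (hε : ε ≠ 0) :
    ∃ K ⊆ Φ '' A, IsCompact K ∧ κ (A \ Φ ⁻¹' K) < ε := by
  rcases isEmpty_or_nonempty Y with hY | ⟨⟨y₀⟩⟩
  · exact ⟨∅, empty_subset _, isCompact_empty, by
      rw [Set.eq_empty_of_isEmpty (A \ _), measure_empty]; exact pos_iff_ne_zero.2 hε⟩
  have hψinj : Function.Injective ψ := injOn_univ.1 hψ.bijOn.injOn
  have hnull : ∀ s : Set Y, MeasurableSet s → NullMeasurableSet (ψ '' s) ν := fun s hs =>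
    (hψ.nullMeasurableSet_image_iff s (subset_univ _)).2 hs.nullMeasurableSet
  -- This is Φ ∘ ψ⁻¹ off a default value. It is only null measurable, so it is replaced by a Borel
  -- version on a Borel set `R`, whose injective image is Borel by Lusin–Souslin.
  set g : ℝ → Z := Function.extend ψ Φ fun _ => Φ y₀ with hg
  have hgψ : ∀ y, g (ψ y) = Φ y := fun y => hψinj.extend_apply _ _ _
  have hgm : NullMeasurable g ν := by
    intro s hs
    have hpre : g ⁻¹' s = ψ '' (Φ ⁻¹' s) ∪ ((range ψ)ᶜ ∩ {_t | Φ y₀ ∈ s}) := by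
      ext t
      by_cases ht : t ∈ range ψ
      · obtain ⟨y, rfl⟩ := ht
        simp [hgψ, hψinj.eq_iff]
      · have h1 : g t = Φ y₀ := Function.extend_apply' _ _ _ ht
        have h2 : ∀ y, ψ y ≠ t := fun y hy => ht ⟨y, hy⟩
        simp [h1, h2]
    rw [hpre]
    refine (hnull _ (hΦ hs)).union (.inter ?_ (MeasurableSet.const _).nullMeasurableSet)
    rw [← image_univ]
    exact (hnull _ .univ).compl
  have hae := hgm.aemeasurable
  set s : Set ℝ := {t | g t = hae.mk g t}
  have hs : NullMeasurableSet s ν :=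
    nullMeasurableSet_univ.congr (ae_eq_univ.2 hae.ae_eq_mk).symm
  have hs0 : ν sᶜ = 0 := hae.ae_eq_mk
  obtain ⟨R, hRsub, hR, hRae⟩ := ((hnull A hA).inter hs).exists_measurable_subset_ae_eq
  have hgR : ∀ y, ψ y ∈ R → hae.mk g (ψ y) = Φ y := fun y hy => (hRsub hy).2.symm.trans (hgψ y)
  have hRinj : InjOn (hae.mk g) R := by
    intro t ht t' ht' heq
    obtain ⟨y, -, rfl⟩ := (hRsub ht).1
    obtain ⟨y', -, rfl⟩ := (hRsub ht').1
    rw [hgR y ht, hgR y' ht'] at heq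
    rw [hinj heq]
  have hQ : MeasurableSet (hae.mk g '' R) := hR.image_of_measurable_injOn hae.measurable_mk hRinj
  obtain ⟨K, hKQ, hK, hKε⟩ := hQ.exists_isCompact_sdiff_lt (μ := κ.map Φ) (measure_ne_top _ _) hε
  refine ⟨K, fun z hz => ?_, hK, ?_⟩
  · obtain ⟨t, ht, rfl⟩ := hKQ hz
    obtain ⟨y, hy, rfl⟩ := (hRsub ht).1
    exact ⟨y, hy, (hgR y ht).symm⟩
  · rw [Measure.map_apply hΦ (hQ.diff hK.measurableSet)] at hKε
    have hAQ : κ (A \ Φ ⁻¹' (hae.mk g '' R)) = 0 := by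
      rw [← hψ.measure_image _ (subset_univ _) (hA.diff (hΦ hQ)).nullMeasurableSet]
      refine measure_mono_null (t := sᶜ ∪ ((ψ '' A ∩ s) \ R)) ?_
        (measure_union_null hs0 (ae_eq_set.1 hRae).2)
      rintro _ ⟨y, ⟨hyA, hy⟩, rfl⟩
      by_cases hys : ψ y ∈ s
      · exact .inr ⟨⟨⟨y, hyA, rfl⟩, hys⟩, fun hyR => hy ⟨ψ y, hyR, hgR y hyR⟩⟩
      · exact .inl hys
    refine (measure_mono (t := (A \ Φ ⁻¹' (hae.mk g '' R)) ∪ Φ ⁻¹' (hae.mk g '' R \ K)) ?_).trans_lt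
      ((measure_union_le _ _).trans_lt (by rwa [hAQ, zero_add]))
    intro y hy
    by_cases h : Φ y ∈ hae.mk g '' R
    · exact .inr ⟨h, hy.2⟩
    · exact .inl ⟨hy.1, h⟩

/-- The image of Φ need not be Borel, but compact sets inside the image of `A` pull back to compact
sets. Applied to complements, this also gives outer regularity. -/
theorem regular_of_isInducing {Y : Type*} [MeasurableSpace Y] [TopologicalSpace Y] {κ : Measure Y}
    [IsFiniteMeasure κ] {ν : Measure ℝ} {Y₀ : Set ℝ} {ψ : Y → ℝ} (hψ : IsIsoMod0 κ ν univ Y₀ ψ)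
    {Z : Type*} [TopologicalSpace Z] [PolishSpace Z] [MeasurableSpace Z] [BorelSpace Z]
    {Φ : Y → Z} (hΦ : Measurable Φ) (hinj : Function.Injective Φ)
    (hind : Topology.IsInducing Φ) : κ.Regular := by
  have key : ∀ A : Set Y, MeasurableSet A → ∀ ε : ENNReal, ε ≠ 0 →
      ∃ K ⊆ A, IsCompact K ∧ IsClosed K ∧ MeasurableSet K ∧ κ (A \ K) < ε := by
    intro A hA ε hε
    obtain ⟨K, hKA, hK, hlt⟩ := exists_isCompact_measure_sdiff_preimage_lt hψ hΦ hinj hA hε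
    refine ⟨Φ ⁻¹' K, fun y hy => ?_, ?_, hK.isClosed.preimage hind.continuous,
      hΦ hK.measurableSet, hlt⟩
    · obtain ⟨a, ha, hay⟩ := hKA hy
      exact hinj hay ▸ ha
    · exact (hind.isCompact_preimage_iff (hKA.trans (image_subset_range _ _))).2 hK
  have hopen : ∀ U : Set Y, IsOpen U → MeasurableSet U := by
    intro U hU
    obtain ⟨V, hV, rfl⟩ := hind.isOpen_iff.1 hU
    exact hΦ hV.measurableSet
  have houter : κ.OuterRegular := by
    refine ⟨fun A hA r hr => ?_⟩
    obtain ⟨K, hKA, -, hKc, hKm, hlt⟩ := key Aᶜ hA.compl (r - κ A) (tsub_pos_of_lt hr).ne'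
    refine ⟨Kᶜ, subset_compl_comm.1 hKA, hKc.isOpen_compl, ?_⟩
    calc κ Kᶜ ≤ κ (A ∪ (Aᶜ \ K)) := measure_mono fun y hy => by
          by_cases h : y ∈ A
          · exact .inl h
          · exact .inr ⟨h, hy⟩
      _ ≤ κ A + κ (Aᶜ \ K) := measure_union_le _ _
      _ < κ A + (r - κ A) := ENNReal.add_lt_add_left (measure_ne_top _ _) hlt
      _ = r := add_tsub_cancel_of_le hr.le
  refine { toOuterRegular := houter, innerRegular := fun U hU r hr => ?_ }
  obtain ⟨K, hKU, hK, -, hKm, hlt⟩ := key U (hopen U hU) (κ U - r) (tsub_pos_of_lt hr).ne'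
  refine ⟨K, hKU, hK, ?_⟩
  by_contra! hle
  have h1 : κ U ≤ κ K + κ (U \ K) := by
    rw [← measure_inter_add_sdiff U hKm, inter_eq_right.2 hKU]
  have h2 : κ U < κ U := calc
    κ U ≤ κ K + κ (U \ K) := h1
    _ < r + (κ U - r) := ENNReal.add_lt_add_of_le_of_lt (measure_ne_top _ _) hle hlt
    _ = κ U := add_tsub_cancel_of_le hr.le
  exact h2.false

end Regular

/-! ### Restriction to a conull forward-invariant set -/

section Subtype

variable {X : Type u} [MeasurableSpace X] {μ : Measure X}

theorem isComplete_comap_val (hμ : μ.IsComplete) {X₁ : Set X} (hX₁ : MeasurableSet X₁) :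
    (μ.comap ((↑) : X₁ → X)).IsComplete := by
  refine ⟨fun s hs => ?_⟩
  rw [comap_subtype_coe_apply hX₁] at hs
  exact (MeasurableEmbedding.subtype_coe hX₁).measurableSet_image.1 (hμ.out' _ hs)

theorem comap_val_apply_preimage {X₁ : Set X} (hX₁ : MeasurableSet X₁) (h : μ X₁ᶜ = 0)
    (A : Set X) : μ.comap ((↑) : X₁ → X) ((↑) ⁻¹' A) = μ A := by
  rw [comap_subtype_coe_apply hX₁, Subtype.image_preimage_coe]
  refine measure_congr (ae_eq_set.2 ⟨?_, ?_⟩)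
  · rw [sdiff_eq_empty.2 inter_subset_right, measure_empty]
  · exact measure_mono_null (fun x hx hx₁ => hx.2 ⟨hx₁, hx.1⟩) h

theorem nullMeasurableSet_comap_val_iff (hμ : μ.IsComplete) {X₁ : Set X}
    (hX₁ : MeasurableSet X₁) (A : Set X₁) :
    NullMeasurableSet A (μ.comap ((↑) : X₁ → X)) ↔ NullMeasurableSet ((↑) '' A : Set X) μ := by
  have := isComplete_comap_val hμ hX₁
  refine ⟨fun h => ?_, fun h => ?_⟩
  · exact ((MeasurableEmbedding.subtype_coe hX₁).measurableSet_image.2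
      h.measurable_of_complete).nullMeasurableSet
  · exact ((MeasurableEmbedding.subtype_coe hX₁).measurableSet_image.1
      h.measurable_of_complete).nullMeasurableSet

theorem IsIsoMod0.comp_val (hμ : μ.IsComplete) {Y : Type v} [MeasurableSpace Y] {ν : Measure Y}
    {X₀ : Set X} {Y₀ : Set Y} {φ : X → Y} (hφ : IsIsoMod0 μ ν X₀ Y₀ φ) {X₁ : Set X}
    (hX₁ : MeasurableSet X₁) (h : μ X₁ᶜ = 0) (hsub : X₁ ⊆ X₀) :
    IsIsoMod0 (μ.comap ((↑) : X₁ → X)) ν univ (φ '' X₁) fun x => φ x where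
  conull_source := by simp
  conull_target := by
    have hnull : μ (X₀ \ X₁) = 0 := measure_mono_null (fun x hx => hx.2) h
    have himg := hφ.measure_image (X₀ \ X₁) sdiff_subset (.of_null hnull)
    refine measure_mono_null (t := Y₀ᶜ ∪ φ '' (X₀ \ X₁)) (fun y hy => ?_)
      (measure_union_null hφ.conull_target (himg.trans hnull))
    by_cases hy₀ : y ∈ Y₀
    · obtain ⟨x, hx, rfl⟩ := hφ.bijOn.surjOn hy₀
      exact .inr ⟨x, ⟨hx, fun hx₁ => hy ⟨x, hx₁, rfl⟩⟩, rfl⟩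
    · exact .inl hy₀
  bijOn := by
    refine ⟨fun x _ => ⟨x, x.2, rfl⟩, fun x _ y _ hxy => ?_, ?_⟩
    · exact Subtype.ext (hφ.bijOn.injOn (hsub x.2) (hsub y.2) hxy)
    · rintro _ ⟨x, hx, rfl⟩
      exact ⟨⟨x, hx⟩, trivial, rfl⟩
  nullMeasurableSet_image_iff A _ := by
    rw [nullMeasurableSet_comap_val_iff hμ hX₁, ← hφ.nullMeasurableSet_image_iff, image_image]
    rintro _ ⟨x, -, rfl⟩
    exact hsub x.2
  measure_image A _ hA := by
    rw [nullMeasurableSet_comap_val_iff hμ hX₁] at hA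
    rw [comap_subtype_coe_apply hX₁, ← hφ.measure_image _ _ hA, image_image]
    rintro _ ⟨x, -, rfl⟩
    exact hsub x.2

theorem areIsomorphic_restrict (hμ : μ.IsComplete) {T : X → X} {X₁ : Set X}
    (hX₁ : MeasurableSet X₁) (h : μ X₁ᶜ = 0) (hne : X₁.Nonempty) (hT : MapsTo T X₁ X₁) :
    AreIsomorphic μ T (μ.comap ((↑) : X₁ → X)) (hT.restrict T X₁ X₁) := by
  classical
  have hval : ∀ x : X, ∀ hx : x ∈ X₁,
      (if hx : x ∈ X₁ then (⟨x, hx⟩ : X₁) else ⟨_, hne.some_mem⟩) = ⟨x, hx⟩ := fun x hx => dif_pos hx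
  have himg : ∀ A ⊆ X₁, ((↑) '' ((fun x : X => if hx : x ∈ X₁ then (⟨x, hx⟩ : X₁)
      else ⟨_, hne.some_mem⟩) '' A) : Set X) = A := by
    intro A hA
    rw [image_image]
    refine (image_congr fun x hx => ?_).trans (image_id A)
    rw [hval x (hA hx)]; rfl
  -- Off `X₁` the map takes an arbitrary value, whence the need for a point of `X₁`.
  refine ⟨X₁, univ, fun x => if hx : x ∈ X₁ then (⟨x, hx⟩ : X₁) else ⟨_, hne.some_mem⟩,
    ⟨h, by simp, ⟨fun _ _ => trivial, fun x hx y hy hxy => ?_, fun x _ => ⟨x, x.2, hval x x.2⟩⟩,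
      fun A hA => ?_, fun A hA _ => ?_⟩, hT, fun _ _ => trivial, fun x hx => ?_⟩
  · simp only [hval x hx, hval y hy] at hxy
    exact congrArg Subtype.val hxy
  · rw [nullMeasurableSet_comap_val_iff hμ hX₁, himg A hA]
  · rw [comap_subtype_coe_apply hX₁, himg A hA]
  · beta_reduce; rw [hval x hx, hval (T x) (hT hx)]; rfl

theorem isNonsingular_restrict {T : X → X} (hTm : MeasurePreserving T μ μ) {X₁ : Set X}
    (hX₁ : MeasurableSet X₁) (h : μ X₁ᶜ = 0) (hT : MapsTo T X₁ X₁) :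
    IsNonsingular (μ.comap ((↑) : X₁ → X)) (hT.restrict T X₁ X₁) := by
  refine ⟨(hTm.measurable.comp measurable_subtype_coe).subtype_mk, fun A hA => ?_⟩
  obtain ⟨A, hA, rfl⟩ := hA
  have : hT.restrict T X₁ X₁ ⁻¹' ((↑) ⁻¹' A) = ((↑) ⁻¹' (T ⁻¹' A) : Set X₁) := rfl
  rw [this, comap_val_apply_preimage hX₁ h, comap_val_apply_preimage hX₁ h,
    hTm.measure_preimage hA.nullMeasurableSet]

theorem isLebesgueSpace_comap_val (hX : IsLebesgueSpace μ) {X₀ X₁ : Set X} {Y₀ : Set ℝ}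
    {φ : X → ℝ}
    (hφ : IsIsoMod0 μ (volume.restrict {t : ℝ | 0 ≤ t ∧ ENNReal.ofReal t < μ univ}) X₀ Y₀ φ)
    (hX₁ : MeasurableSet X₁) (h : μ X₁ᶜ = 0) (hsub : X₁ ⊆ X₀) :
    IsLebesgueSpace (μ.comap ((↑) : X₁ → X)) := by
  refine ⟨isComplete_comap_val hX.complete hX₁, univ, φ '' X₁, fun x => φ x, ?_⟩
  have huniv : μ.comap ((↑) : X₁ → X) univ = μ univ := comap_val_apply_preimage hX₁ h univ
  rw [huniv]
  exact hφ.comp_val hX.complete hX₁ h hsub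

end Subtype

/-! ### Metrics pulled back from the Cantor space -/

section Coding

variable {X : Type u}

open Classical in
/-- The sequence that records which of the sets `F i` contain `x`. -/
noncomputable def coding (F : ℕ → Set X) (x : X) : ℕ → Bool := fun i => decide (x ∈ F i)

theorem coding_apply_eq_iff {F : ℕ → Set X} {x y : X} {i : ℕ} :
    coding F x i = coding F y i ↔ (x ∈ F i ↔ y ∈ F i) := by
  simp [coding]

theorem measurable_coding [MeasurableSpace X] {F : ℕ → Set X} (hF : ∀ i, MeasurableSet (F i)) :
    Measurable (coding F) := by
  refine measurable_pi_lambda _ fun i => measurable_to_bool ?_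
  convert hF i using 1
  ext x
  simp [coding]

/-- The metric on a set of points that is pulled back from the Cantor space by a coding. -/
noncomputable abbrev codingMetric {F : ℕ → Set X} {X₁ : Set X} (h : InjOn (coding F) X₁) :
    MetricSpace X₁ :=
  MetricSpace.induced (fun x : X₁ => coding F x) (injOn_iff_injective.1 h) PiNat.metricSpace

theorem dist_codingMetric_le {F : ℕ → Set X} {X₁ : Set X} (h : InjOn (coding F) X₁) {x y : X₁}
    {n : ℕ} (hxy : ∀ i < n, ((x : X) ∈ F i ↔ (y : X) ∈ F i)) :
    (codingMetric h).dist x y ≤ (1 / 2) ^ n :=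
  PiNat.mem_cylinder_iff_dist_le.1 fun i hi => coding_apply_eq_iff.2 (hxy i hi)

theorem mem_iff_mem_of_dist_codingMetric_lt {F : ℕ → Set X} {X₁ : Set X}
    (h : InjOn (coding F) X₁) {x y : X₁} {n : ℕ} (hxy : (codingMetric h).dist x y < (1 / 2) ^ n) :
    (x : X) ∈ F n ↔ (y : X) ∈ F n :=
  coding_apply_eq_iff.1 (PiNat.apply_eq_of_dist_lt hxy le_rfl)

theorem isGoodMetric_codingMetric [MeasurableSpace X] {μ : Measure X} [IsFiniteMeasure μ]
    (hμ : μ.IsComplete) {ν : Measure ℝ} {X₀ : Set X} {Y₀ : Set ℝ} {φ : X → ℝ}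
    (hφ : IsIsoMod0 μ ν X₀ Y₀ φ) {F : ℕ → Set X} (hF : ∀ i, MeasurableSet (F i)) {X₁ : Set X}
    (hX₁ : MeasurableSet X₁) (h0 : μ X₁ᶜ = 0) (hsub : X₁ ⊆ X₀) (h : InjOn (coding F) X₁)
    (hsupp : ∀ x ∈ X₁, coding F x ∈ (μ.map (coding F)).support) :
    @IsGoodMetric X₁ _ (codingMetric h) (μ.comap (↑)) := by
  let := codingMetric h
  have hind : Topology.IsInducing fun x : X₁ => coding F x := ⟨rfl⟩
  have hm := measurable_coding hF
  have hm₁ : Measurable fun x : X₁ => coding F x := hm.comp measurable_subtype_coe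
  have hfin : IsFiniteMeasure (μ.comap ((↑) : X₁ → X)) :=
    ⟨(comap_val_apply_preimage hX₁ h0 univ).trans_lt (measure_lt_top _ _)⟩
  refine ⟨fun U hU => ?_, fun U hU hne => ?_, ?_⟩
  · obtain ⟨V, hV, rfl⟩ := hind.isOpen_iff.1 hU
    exact hm₁ hV.measurableSet
  · obtain ⟨V, hV, rfl⟩ := hind.isOpen_iff.1 hU
    obtain ⟨x, hx⟩ := hne
    have hpos := Measure.mem_support_iff_forall _ |>.1 (hsupp x x.2) V (hV.mem_nhds hx)
    rw [Measure.map_apply hm hV.measurableSet] at hpos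
    exact hpos.trans_eq (comap_val_apply_preimage hX₁ h0 (coding F ⁻¹' V)).symm
  · have : PolishSpace (ℕ → Bool) := {}
    exact regular_of_isInducing (hφ.comp_val hμ hX₁ h0 hsub) hm₁ (injOn_iff_injective.1 h) hind

end Coding

/-! ### The lower bound on frequent targets -/

section Sensitivity

variable {X : Type u} [MeasurableSpace X] {μ : Measure X}

theorem exists_measurableSet_separating (hμ : μ.IsComplete) {ν : Measure ℝ}
    {X₀ : Set X} {Y₀ : Set ℝ} {φ : X → ℝ} (hφ : IsIsoMod0 μ ν X₀ Y₀ φ) :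
    ∃ E : ℚ → Set X, (∀ q, MeasurableSet (E q)) ∧
      ∀ x ∈ X₀, ∀ y ∈ X₀, (∀ q, x ∈ E q ↔ y ∈ E q) → x = y := by
  refine ⟨fun q => X₀ ∩ φ ⁻¹' Iio (q : ℝ), fun q => ?_, fun x hx y hy hxy => ?_⟩
  · refine NullMeasurableSet.measurable_of_complete (μ := μ)
      ((hφ.nullMeasurableSet_image_iff _ inter_subset_left).1 ?_)
    rw [image_inter_preimage, hφ.bijOn.image_eq]
    refine .inter ?_ measurableSet_Iio.nullMeasurableSet
    exact (NullMeasurableSet.of_null hφ.conull_target).of_compl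
  · refine hφ.bijOn.injOn hx hy (le_antisymm ?_ ?_) <;> refine le_of_not_gt fun hlt => ?_ <;>
      obtain ⟨q, hq₁, hq₂⟩ := exists_rat_btwn hlt
    · exact hq₂.not_gt ((hxy q).2 ⟨hy, hq₁⟩).2
    · exact hq₂.not_gt ((hxy q).1 ⟨hx, hq₁⟩).2

/-- Given sets `C m`, any countable family of sets can be modified to a
sequence `F`, none of whose first `m` members meets `C m`. -/
theorem exists_sequence_sdiff {C : ℕ → Set X} (hC : ∀ m, MeasurableSet (C m)) {ι : Type*}
    [Countable ι] [Nonempty ι] {G : ι → Set X} (hG : ∀ j, MeasurableSet (G j)) :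
    ∃ F : ℕ → Set X, (∀ i, MeasurableSet (F i)) ∧ (∀ i m, i < m → Disjoint (F i) (C m)) ∧
      ∀ j k, ∃ i, F i = G j \ ⋃ m ≥ k, C m := by
  obtain ⟨f, hf⟩ := exists_surjective_nat ι
  refine ⟨fun i => G (f i.unpair.1) \ ⋃ m ≥ i.unpair.2, C m, fun i => (hG _).diff
    (.biUnion (to_countable _) fun m _ => hC m), fun i m him => disjoint_left.2 fun x hx hxC => ?_,
    fun j k => ?_⟩
  · exact hx.2 (mem_iUnion₂.2 ⟨m, (Nat.unpair_right_le i).trans him.le, hxC⟩)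
  · obtain ⟨i, rfl⟩ := hf j
    exact ⟨Nat.pair i k, by simp⟩

theorem measure_iInter_preimage_iterate_compl {T : X → X} (hT : MeasurePreserving T μ μ)
    {G : Set X} (hG : MeasurableSet G) (h : μ Gᶜ = 0) : μ (⋂ n, T^[n] ⁻¹' G)ᶜ = 0 := by
  rw [compl_iInter, measure_iUnion_null_iff]
  intro n
  rw [← preimage_compl, (hT.iterate n).measure_preimage hG.compl.nullMeasurableSet, h]

/-- For a measurably sensitive measure-preserving transformation of a finite Lebesgue space,
frequent targets are never small. -/
theorem IsMeasurablySensitive.exists_le_measure [IsFiniteMeasure μ] (hμ : μ ≠ 0)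
    (hX : IsLebesgueSpace μ) {T : X → X} (hT : MeasurePreserving T μ μ)
    (hsens : IsMeasurablySensitive μ T) :
    ∃ c : ENNReal, 0 < c ∧ ∀ C, MeasurableSet C → IsFrequentTarget μ T C → c ≤ μ C := by
  by_contra! hcon
  obtain ⟨ε, hε, hsum⟩ := ENNReal.exists_pos_sum_of_countable one_ne_zero ℕ
  choose C hC hCt hCε using fun m => hcon (ε m) (ENNReal.coe_pos.2 (hε m))
  choose B hB hB0 hBC using hCt
  have hμc := hX.complete
  obtain ⟨X₀, Y₀, φ, hφ⟩ := hX.exists_iso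
  obtain ⟨E, hE, hEsep⟩ := exists_measurableSet_separating hμc hφ
  have hX₀ : MeasurableSet X₀ :=
    ((NullMeasurableSet.of_null hφ.conull_source).of_compl).measurable_of_complete
  have hCsum : ∑' m, μ (C m) ≠ ⊤ :=
    (((ENNReal.tsum_le_tsum fun m => (hCε m).le).trans_lt hsum).trans ENNReal.one_lt_top).ne
  set U : ℕ → Set X := fun k => ⋃ m ≥ k, C m with hU
  have hUm : ∀ k, MeasurableSet (U k) := fun k => .biUnion (to_countable _) fun m _ => hC m
  have hUanti : Antitone U := fun k l hkl x hx => by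
    obtain ⟨m, hm, hx⟩ := mem_iUnion₂.1 hx
    exact mem_iUnion₂.2 ⟨m, hkl.trans hm, hx⟩
  have hN : μ (⋂ k, U k) = 0 := by
    have := measure_limsup_atTop_eq_zero hCsum
    rwa [limsup_eq_iInf_iSup_of_nat] at this
  have hNm : MeasurableSet (⋂ k, U k) := .iInter hUm
  have hUlim : Tendsto (fun k => μ (U k)) atTop (nhds 0) := hN ▸ tendsto_measure_iInter_atTop
    (fun k => (hUm k).nullMeasurableSet) hUanti ⟨0, measure_ne_top _ _⟩
  -- The family `E` is included to separate points, the family `B` so that some ball lies inside `B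
  -- m`.
  obtain ⟨F, hF, hFC, hFG⟩ := exists_sequence_sdiff hC (G := Sum.elim E B)
    (Sum.forall.2 ⟨hE, hB⟩)
  have hm := measurable_coding hF
  -- The points in infinitely many `C m` are dropped for injectivity of the coding, those coded
  -- outside the support so that nonempty open sets have positive measure.
  set G : Set X := X₀ ∩ (⋂ k, U k)ᶜ ∩ coding F ⁻¹' (μ.map (coding F)).support with hG_def
  have hsuppm : MeasurableSet (μ.map (coding F)).support := Measure.isClosed_support.measurableSet
  have hGm : MeasurableSet G := (hX₀.inter hNm.compl).inter (hm hsuppm)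
  have hG0 : μ Gᶜ = 0 := by
    rw [hG_def, compl_inter, compl_inter, compl_compl]
    refine measure_union_null (measure_union_null hφ.conull_source hN) ?_
    rw [← preimage_compl, ← Measure.map_apply hm hsuppm.compl]
    exact Measure.measure_compl_support
  set X₁ : Set X := ⋂ n, T^[n] ⁻¹' G
  have hX₁ : MeasurableSet X₁ := .iInter fun n => (hT.iterate n).measurable hGm
  have h0 : μ X₁ᶜ = 0 := measure_iInter_preimage_iterate_compl hT hGm hG0
  have hX₁G : X₁ ⊆ G := iInter_subset _ 0
  have hmaps : MapsTo T X₁ X₁ := fun x hx =>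
    mem_iInter.2 fun n => mem_iInter.1 hx (n + 1)
  have hsub : X₁ ⊆ X₀ := fun x hx => (hX₁G hx).1.1
  have hne : X₁.Nonempty := by
    obtain ⟨x, -, hx⟩ := exists_mem_of_ae (D := univ) (by simpa [pos_iff_ne_zero] using hμ)
      (measure_eq_zero_iff_ae_notMem.1 h0)
    exact ⟨x, not_not.1 hx⟩
  have hinj : InjOn (coding F) X₁ := by
    intro x hx y hy hxy
    refine hEsep x (hsub hx) y (hsub hy) fun q => ?_
    obtain ⟨k, hk⟩ := not_forall.1 fun hall => (hX₁G hx).1.2 (mem_iInter.2 hall)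
    obtain ⟨l, hl⟩ := not_forall.1 fun hall => (hX₁G hy).1.2 (mem_iInter.2 hall)
    obtain ⟨i, hi⟩ := hFG (.inl q) (max k l)
    have hiff := coding_apply_eq_iff.1 (congrFun hxy i)
    rw [hi] at hiff
    have hk' : x ∉ U (max k l) := fun h => hk (hUanti (le_max_left k l) h)
    have hl' : y ∉ U (max k l) := fun h => hl (hUanti (le_max_right k l) h)
    exact ⟨fun h => (hiff.1 ⟨h, hk'⟩).1, fun h => (hiff.2 ⟨h, hl'⟩).1⟩
  let := codingMetric hinj
  obtain ⟨δ, hδ, hs⟩ := hsens X₁ (μ.comap (↑)) (hmaps.restrict T X₁ X₁)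
    (isLebesgueSpace_comap_val hX hφ hX₁ h0 hsub) (isNonsingular_restrict hT hX₁ h0 hmaps)
    (areIsomorphic_restrict hμc hX₁ h0 hne hmaps)
    (isGoodMetric_codingMetric hμc hφ hF hX₁ h0 hsub hinj fun x hx => (hX₁G hx).2)
  have hiter : ∀ n (x : X₁), ((hmaps.restrict T X₁ X₁)^[n] x : X) = T^[n] x := fun n x =>
    Function.Semiconj.iterate_right (f := ((↑) : X₁ → X)) (fun _ => rfl) n x
  obtain ⟨m, hmδ⟩ := exists_pow_lt_of_lt_one hδ (one_half_lt_one (α := ℝ))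
  -- For this k the set `B m \ U k`, which is one of the `F i`, has positive measure.
  obtain ⟨k, hk⟩ := (hUlim.eventually_lt_const (hB0 m)).exists
  obtain ⟨i, hi⟩ := hFG (.inr m) k
  have hFpos : 0 < μ (F i) := by
    rw [hi]; exact (tsub_pos_of_lt hk).trans_le le_measure_sdiff
  have hFB : F i ⊆ B m := by rw [hi]; exact sdiff_subset
  have hgen : ∀ᵐ x ∂μ, ∀ n, B m ≤ᵐ[μ] T^[n] ⁻¹' C m → x ∈ B m → T^[n] x ∈ C m := by
    refine ae_all_iff.2 fun n => ?_
    by_cases h : B m ≤ᵐ[μ] T^[n] ⁻¹' C m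
    · filter_upwards [h] with x hx _ hxB using hx hxB
    · exact .of_forall fun x h' => absurd h' h
  obtain ⟨x, hxF, hxgen, hx₁⟩ := exists_mem_of_ae hFpos
    (hgen.and (measure_eq_zero_iff_ae_notMem.1 h0))
  lift x to X₁ using not_not.1 hx₁
  -- The radius 2^(-i) makes the ball decide membership in `F i`, so it lies in `B m`.
  obtain ⟨N, hNs⟩ := hs x ((1 / 2) ^ i) (by positivity)
  obtain ⟨n, hn, hBn⟩ := frequently_atTop.1 (hBC m) N
  refine (hNs n hn).ne' ?_
  rw [comap_subtype_coe_apply hX₁]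
  refine measure_mono_null ?_ (ae_le_set.1 hBn)
  rintro _ ⟨y, ⟨hy, hdist⟩, rfl⟩
  have hyF : (y : X) ∈ F i := (mem_iff_mem_of_dist_codingMetric_lt hinj hy).2 hxF
  -- If the images of x and y were both in `C m`, neither would meet `F j` for j < m, so they would
  -- be within 2^(-m) < δ.
  refine ⟨hFB hyF, fun hyC => hdist.not_ge ((dist_codingMetric_le hinj fun j hj => ?_).trans hmδ.le)⟩
  rw [hiter, hiter]
  exact iff_of_false (fun h => disjoint_left.1 (hFC j m hj) h (hxgen n hBn (hFB hxF)))
    fun h => disjoint_left.1 (hFC j m hj) h hyC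

end Sensitivity

end MeasurableSensitivity

theorem mainTheorem1 {X : Type u} [MeasurableSpace X] (μ : Measure X) [IsFiniteMeasure μ]
    (hμ : μ ≠ 0) (hX : MeasurableSensitivity.IsLebesgueSpace μ)
    (T : X → X) (hT : Ergodic T μ)
    (hsens : MeasurableSensitivity.IsMeasurablySensitive μ T) :
    ∃ n : ℕ, 1 ≤ n ∧ ∃ A : Fin n → Set X,
      (∀ i, MeasurableSet (A i)) ∧
      (∀ i, 0 < μ (A i)) ∧
      (∀ i j, i ≠ j → Disjoint (A i) (A j)) ∧
      (∀ i, T^[n] ⁻¹' (A i) = A i) ∧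
      μ (⋃ i, A i)ᶜ = 0 ∧
      (∀ i, MeasurableSensitivity.IsLightlyMixing (μ.restrict (A i)) (T^[n])) := by
  obtain ⟨c, hc, h⟩ := hsens.exists_le_measure hμ hX hT.toMeasurePreserving
  exact MeasurableSensitivity.exists_cyclic_decomposition hμ hT hc h
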